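/- Let $E_0,E_1,E_2,\ldots$ be the Euler numbers, the integers given by $E_0=1$ and the recursion $\sum_{0\le k\le n,\ 2\mid k}\binom nk E_{n-k}=0$ for $n=1,2,3,\ldots$. Let $p>3$ be a prime. Then $$\sum_{k=0}^{(p-1)/2}(21k+8)\binom{2k}k^3\equiv 8p+(-1)^{(p-1)/2}32p^3E_{p-3}\pmod{p^4},$$ and $$\sum_{k=1}^{(p-1)/2}\frac{21k-8}{k^3\binom{2k}k^3}\equiv(-1)^{(p+1)/2}4E_{p-3}\pmod p,$$ where the second congruence is between rational numbers: $a\equiv b\pmod p$ means that $a-b=pc$ for some rational number $c$ whose denominator in lowest terms is not divisible by $p$. -/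

import Mathlib

/-- The Euler numbers `E₀, E₁, E₂, … = 1, 0, -1, 0, 5, 0, -61, …`, given by `E₀ = 1` and the
recursion `∑_{0 ≤ k ≤ n, 2 ∣ k} (n choose k) E_{n-k} = 0` for `n ≥ 1`, solved for the term `k = 0`
(the summation index `j` below is `k - 1`). See `eulerNumber_recursion`. -/
def eulerNumber : ℕ → ℤ
  | 0 => 1
  | n + 1 => -∑ j : Fin (n + 1),
      if Even ((j : ℕ) + 1) then
        ((n + 1).choose ((j : ℕ) + 1) : ℤ) * eulerNumber (n - (j : ℕ))
      else 0
decreasing_by omega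

theorem eulerNumber_zero : eulerNumber 0 = 1 := by
  rw [eulerNumber]

/-- The defining recursion of the Euler numbers. -/
theorem eulerNumber_recursion (n : ℕ) (hn : 1 ≤ n) :
    ∑ k ∈ (Finset.range (n + 1)).filter Even, (n.choose k : ℤ) * eulerNumber (n - k) = 0 := by
  obtain ⟨m, rfl⟩ : ∃ m, n = m + 1 := ⟨n - 1, by omega⟩
  rw [Finset.sum_filter, Finset.sum_range_succ', Finset.sum_range]
  simp only [Nat.reduceSubDiff, Even.zero, if_true, Nat.choose_zero_right, Nat.sub_zero,
    Nat.cast_one, one_mul]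
  conv_lhs => arg 2; rw [eulerNumber]
  exact add_neg_cancel _

/-- Congruence `a ≡ b (mod m)` of rational numbers, in the ring of rationals whose denominator
is coprime to `m`: the difference `a - b` is `m` times a rational number whose
denominator (in lowest terms) is coprime to `m`. -/
def RatModEq (m : ℕ) (a b : ℚ) : Prop :=
  ∃ c : ℚ, c.den.Coprime m ∧ a - b = (m : ℚ) * c

open Finset

/-! Write `p = 2n + 1`. A WZ-type identity (`sum_cube_centralBinom`) evaluates the first sum up to
`k = p - 1` as `4p C(2p, p) ∑_{k<p} C(p-1+k, k)²`. Modulo `p³` the binomial is 2 and the sum of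
squares is 1, both because `∑_{k<p} 1/k² ≡ 0 (mod p)`; so the sum over all `k < p` is `8p` modulo
`p⁴`. For the terms with `k = p - j`, `1 ≤ j ≤ n`, one has `C(2k, k) ≡ -2p / (j C(2j, j))` modulo
`p²`, so they add up to `8p³` times the second sum, and both claims reduce to the second. Two more
telescoping identities express `∑ (21k-8)/(k³C(2k,k)³)` and `∑ (-1)^k/k²` through `∑ 1/(k²C(2k,k))`
and kernel sums. By Wilson's theorem the kernels coincide modulo `p`, which leaves `-2 ∑ (-1)^k/k²`.
This is an alternating sum of odd `(p-3)`-th powers, given by Euler numbers. -/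

/-! ### Closed form of the sum of cubes -/

theorem natCast_choose_two_mul_succ (n : ℕ) :
    ((2 * (n + 1)).choose (n + 1) : ℚ) * (n + 1) = 2 * (2 * n + 1) * ((2 * n).choose n : ℚ) := by
  have h := congrArg (Nat.cast (R := ℚ)) (Nat.succ_mul_centralBinom_succ n)
  simp only [Nat.centralBinom] at h
  push_cast at h
  linear_combination h

/-- WZ pair: the difference in `n` of the summand is a difference in `k` of the right-hand side,
which vanishes at `K = 0`. -/
theorem sum_cube_centralBinom_telescope (n K : ℕ) :
    ∑ k ∈ range K, ((n + 2 : ℚ) * ((2 * (n + 2)).choose (n + 2) : ℚ) * ((n + 1 + k).choose k : ℚ) ^ 2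
      - (n + 1 : ℚ) * ((2 * (n + 1)).choose (n + 1) : ℚ) * ((n + k).choose k : ℚ) ^ 2)
    = K ^ 2 * (2 * K + 3 * (n + 1)) / (n + 1) ^ 2 * ((2 * (n + 1)).choose (n + 1) : ℚ) *
      ((n + K).choose K : ℚ) ^ 2 := by
  have hc := natCast_choose_two_mul_succ (n + 1)
  have h1 : ∀ k : ℕ, ((n + 1 + k).choose k : ℚ) = (n + 1 + k) / (n + 1) * ((n + k).choose k : ℚ) := by
    intro k
    have := Nat.add_one_mul_choose_eq (n + k) n
    rw [Nat.choose_symm_add (a := n) (b := k),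
      show (n + k).succ.choose n.succ = (n + 1 + k).choose k by
        rw [show (n + k).succ = (n + 1) + k by omega]; exact Nat.choose_symm_add] at this
    have h : (((n + k).succ * (n + k).choose k : ℕ) : ℚ) = (((n + 1 + k).choose k * n.succ : ℕ) : ℚ) := by
      rw [this]
    push_cast at h
    field_simp
    linear_combination -h
  have h2 : ∀ k : ℕ, ((n + (k + 1)).choose (k + 1) : ℚ) = (n + 1 + k) / (k + 1) * ((n + k).choose k : ℚ) := by
    intro k
    have := Nat.add_one_mul_choose_eq (n + k) k
    have h : (((n + k).succ * (n + k).choose k : ℕ) : ℚ)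
      = (((n + k).succ.choose k.succ * k.succ : ℕ) : ℚ) := by rw [this]
    push_cast at h
    rw [show n + (k + 1) = n + k + 1 by ring]
    field_simp
    linear_combination -h
  induction K with
  | zero => simp
  | succ K ih =>
    rw [sum_range_succ, ih, h1, h2]
    push_cast at hc ⊢
    rw [show (n + 2 : ℚ) * ((2 * (n + 2)).choose (n + 2) : ℚ)
      = 2 * (2 * n + 3) * ((2 * (n + 1)).choose (n + 1) : ℚ) by linear_combination hc]
    field_simp
    ring

theorem sum_cube_centralBinom (n : ℕ) :
    ∑ k ∈ range (n + 1), (21 * (k : ℤ) + 8) * ((2 * k).choose k : ℤ) ^ 3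
    = 4 * (n + 1) * ((2 * (n + 1)).choose (n + 1) : ℤ) *
      ∑ k ∈ range (n + 1), ((n + k).choose k : ℤ) ^ 2 := by
  induction n with
  | zero => simp
  | succ n ih =>
    rw [sum_range_succ, ih]
    -- With `C = C(2n+2, n+1)`, four times the telescoped value is `5(n+1)C³` and the extra top term
    -- is `8(2n+3)C³`; together `(21(n+1)+8)C³`.
    have key := sum_cube_centralBinom_telescope n (n + 1)
    rw [sum_sub_distrib, ← mul_sum, ← mul_sum] at key
    have hs : ((n + 1 + (n + 1)).choose (n + 1) : ℚ) = 2 * ((n + (n + 1)).choose (n + 1) : ℚ) := by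
      have := Nat.add_one_mul_choose_eq (n + (n + 1)) n
      have e : (n + (n + 1)).choose n = (n + (n + 1)).choose (n + 1) := Nat.choose_symm_add
      rw [e] at this
      have h : (((n + (n + 1)).succ * (n + (n + 1)).choose (n + 1) : ℕ) : ℚ)
        = (((n + (n + 1)).succ.choose n.succ * n.succ : ℕ) : ℚ) := by rw [this]
      rw [show (n + (n + 1)).succ = n + 1 + (n + 1) by omega] at h
      push_cast at h
      have h0 : (n + 1 : ℚ) ≠ 0 := by positivity
      apply mul_left_cancel₀ h0
      linear_combination -h
    have hc := natCast_choose_two_mul_succ (n + 1)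
    have goal : (4 * (n + 1) * ((2 * (n + 1)).choose (n + 1) : ℚ) *
        ∑ k ∈ range (n + 1), ((n + k).choose k : ℚ) ^ 2)
        + (21 * ((n + 1 : ℕ) : ℚ) + 8) * ((2 * (n + 1)).choose (n + 1) : ℚ) ^ 3
        = 4 * ((n + 1 : ℕ) + 1) * ((2 * (n + 1 + 1)).choose (n + 1 + 1) : ℚ) *
      ∑ k ∈ range (n + 1 + 1), ((n + 1 + k).choose k : ℚ) ^ 2 := by
      rw [sum_range_succ _ (n + 1)]
      have hs' : ((2 * (n + 1)).choose (n + 1) : ℚ) = 2 * ((n + (n + 1)).choose (n + 1) : ℚ) := by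
        rw [← hs, two_mul]
      rw [hs]
      rw [show n + 1 + 1 = n + 2 by ring]
      rw [hs'] at key hc ⊢
      push_cast at key hc ⊢
      field_simp at key
      linear_combination (-4) * key - 16 * ((n + (n + 1)).choose (n + 1) : ℚ) ^ 2 * hc
    exact_mod_cast goal

/-! ### Telescoping identities over a field where `1, …, 2N` are invertible -/

section
variable {K : Type*} [Field K]

theorem natCast_factorial_ne_zero {N : ℕ} (h : ∀ m : ℕ, 1 ≤ m → m ≤ N → (m : K) ≠ 0) {m : ℕ}
    (hm : m ≤ N) : (m.factorial : K) ≠ 0 := by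
  induction m with
  | zero => simp
  | succ m ih =>
    rw [Nat.factorial_succ, Nat.cast_mul]
    exact mul_ne_zero (h _ (by omega) hm) (ih (by omega))

theorem natCast_choose_two_mul {N : ℕ} (h : ∀ m : ℕ, 1 ≤ m → m ≤ 2 * N → (m : K) ≠ 0) {n : ℕ}
    (hn : n ≤ N) : ((2 * n).choose n : K) = ((2 * n).factorial : K) / (n.factorial : K) ^ 2 := by
  have hf : (n.factorial : K) ≠ 0 := natCast_factorial_ne_zero h (by omega)
  have := Nat.add_choose_mul_factorial_mul_factorial n n
  rw [← two_mul] at this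
  rw [eq_div_iff (pow_ne_zero 2 hf), ← this]
  push_cast
  ring

/-- The summand `1 / (C(2n, n) (k C(n + k, k))²)` with `k = j + 1`. -/
def cubeKernel (K : Type*) [Field K] (n j : ℕ) : K :=
  (n.factorial : K) ^ 4 * (j.factorial : K) ^ 2 /
    (((2 * n).factorial : K) * ((n + j + 1).factorial : K) ^ 2)

/-- WZ telescoping in `j`. The last term is the boundary value at `J = 0`; it equals `-3/((n+1)²
C(2n+2, n+1))` and cancels the new term of `3 ∑ 1/(k² C(2k, k))`. -/
theorem sum_cubeKernel_sub {N : ℕ} (h : ∀ m : ℕ, 1 ≤ m → m ≤ 2 * N → (m : K) ≠ 0)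
    {n J : ℕ} (hn : n + 1 ≤ N) (hJ : J ≤ n) :
    ∑ j ∈ range J, (cubeKernel K (n + 1) j - cubeKernel K n j)
    = (2 * J + 3 * n + 3) * (n + 1) * (n.factorial : K) ^ 4 * (J.factorial : K) ^ 2 /
        (((2 * n + 2).factorial : K) * ((n + 1 + J).factorial : K) ^ 2)
      - 3 / ((2 * n + 2).factorial : K) * (n.factorial : K) ^ 2 := by
  induction J with
  | zero =>
    have hf : (n.factorial : K) ≠ 0 := natCast_factorial_ne_zero h (by omega)
    have hf2 : ((2 * n + 2).factorial : K) ≠ 0 := natCast_factorial_ne_zero h (by omega)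
    have h1 : (n + 1 : K) ≠ 0 := by exact_mod_cast h (n + 1) (by omega) (by omega)
    simp only [range_zero, sum_empty, Nat.factorial_zero, Nat.add_zero, Nat.factorial_succ n]
    push_cast
    field_simp
    ring
  | succ J ih =>
    rw [sum_range_succ, ih (by omega)]
    have hf : (n.factorial : K) ≠ 0 := natCast_factorial_ne_zero h (by omega)
    have hf2 : ((2 * n).factorial : K) ≠ 0 := natCast_factorial_ne_zero h (by omega)
    have hf3 : ((n + J).factorial : K) ≠ 0 := natCast_factorial_ne_zero h (by omega)
    have h1 : (n + 1 : K) ≠ 0 := by exact_mod_cast h (n + 1) (by omega) (by omega)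
    have h2 : (2 * n + 1 : K) ≠ 0 := by exact_mod_cast h (2 * n + 1) (by omega) (by omega)
    have h3 : (2 : K) ≠ 0 := by exact_mod_cast h 2 (by omega) (by omega)
    have h4 : (n + J + 1 : K) ≠ 0 := by exact_mod_cast h (n + J + 1) (by omega) (by omega)
    have h5 : (n + J + 2 : K) ≠ 0 := by exact_mod_cast h (n + J + 2) (by omega) (by omega)
    unfold cubeKernel
    rw [show 2 * (n + 1) = 2 * n + 1 + 1 by ring, show n + 1 + J + 1 = n + J + 1 + 1 by ring,
      show n + 1 + (J + 1) = n + J + 1 + 1 by ring, show n + 1 + J = n + J + 1 by ring]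
    simp only [Nat.factorial_succ]
    push_cast
    rw [show (2 * n + 1 + 1 : K) = 2 * (n + 1) by ring, show (n + J + 1 + 1 : K) = n + J + 2 by ring]
    field_simp
    ring

theorem sum_div_cube_centralBinom {N : ℕ} (h : ∀ m : ℕ, 1 ≤ m → m ≤ 2 * N → (m : K) ≠ 0)
    {n : ℕ} (hn : n ≤ N) :
    ∑ i ∈ range n, (21 * (i + 1 : K) - 8) / ((i + 1 : K) ^ 3 * ((2 * (i + 1)).choose (i + 1) : K) ^ 3)
    = 3 * ∑ i ∈ range n, 1 / ((i + 1 : K) ^ 2 * ((2 * (i + 1)).choose (i + 1) : K))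
      + ∑ j ∈ range n, cubeKernel K n j := by
  induction n with
  | zero => simp
  | succ n ih =>
    have key := sum_cubeKernel_sub h hn le_rfl
    rw [sum_sub_distrib] at key
    rw [sum_range_succ, ih (by omega), sum_range_succ _ n, sum_range_succ _ n,
      sub_eq_iff_eq_add.1 key, natCast_choose_two_mul h hn]
    have hf : (n.factorial : K) ≠ 0 := natCast_factorial_ne_zero h (by omega)
    have hf2 : ((2 * n).factorial : K) ≠ 0 := natCast_factorial_ne_zero h (by omega)
    have h1 : (n + 1 : K) ≠ 0 := by exact_mod_cast h (n + 1) (by omega) (by omega)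
    have h2 : (2 * n + 1 : K) ≠ 0 := by exact_mod_cast h (2 * n + 1) (by omega) (by omega)
    have h3 : (2 : K) ≠ 0 := by exact_mod_cast h 2 (by omega) (by omega)
    generalize ∑ i ∈ range n, 1 / ((i + 1 : K) ^ 2 * ((2 * (i + 1)).choose (i + 1) : K)) = A
    generalize ∑ j ∈ range n, cubeKernel K n j = B
    unfold cubeKernel
    rw [show 2 * (n + 1) = 2 * n + 1 + 1 by ring, show n + 1 + n + 1 = 2 * n + 1 + 1 by ring,
      show n + 1 + n = 2 * n + 1 by ring]
    simp only [Nat.factorial_succ]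
    push_cast
    rw [show (2 * n + 1 + 1 : K) = 2 * (n + 1) by ring]
    -- `2n + 1` becomes an atom while denominators are cleared.
    obtain ⟨w, hw⟩ : ∃ w : K, w = 2 * n + 1 := ⟨_, rfl⟩
    rw [← hw] at h2 ⊢
    field_simp
    rw [hw]
    ring

/-- The summand `(-1)^(n + k) / (k² C(n, k) C(n + k, k))` with `k = j + 1`. -/
def aperyKernel (K : Type*) [Field K] (n j : ℕ) : K :=
  (-1) ^ (n + j + 1) * (j.factorial : K) ^ 2 * ((n - (j + 1)).factorial : K) /
    ((n + j + 1).factorial : K)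

/-- The boundary value at `J = 0` is the new term of `-2 ∑ (-1)^k/k²`. At `J = n` the other term is
`-4 n!²/(2n+2)!`; the diagonal kernel adds `n!²/(2n+2)!`, giving the coefficient `-3`. -/
theorem sum_aperyKernel_sub {N : ℕ} (h : ∀ m : ℕ, 1 ≤ m → m ≤ 2 * N → (m : K) ≠ 0)
    {n J : ℕ} (hn : n + 1 ≤ N) (hJ : J ≤ n) :
    ∑ j ∈ range J, (aperyKernel K (n + 1) j - aperyKernel K n j)
    = -2 / (n + 1) * (-1) ^ (n + J) * (J.factorial : K) ^ 2 * ((n - J).factorial : K) /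
        ((n + J + 1).factorial : K) + 2 * (-1) ^ n / (n + 1) ^ 2 := by
  induction J with
  | zero =>
    have hf : (n.factorial : K) ≠ 0 := natCast_factorial_ne_zero h (by omega)
    have h1 : (n + 1 : K) ≠ 0 := by exact_mod_cast h (n + 1) (by omega) (by omega)
    simp only [range_zero, sum_empty, Nat.factorial_zero, Nat.add_zero, Nat.factorial_succ n,
      Nat.sub_zero]
    push_cast
    field_simp
    ring
  | succ J ih =>
    rw [sum_range_succ, ih (by omega)]
    obtain ⟨d, rfl⟩ : ∃ d, n = J + 1 + d := ⟨n - (J + 1), by omega⟩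
    unfold aperyKernel
    rw [show J + 1 + d - J = d + 1 by omega, show J + 1 + d + 1 - (J + 1) = d + 1 by omega,
      show J + 1 + d - (J + 1) = d by omega, show J + 1 + d + 1 + J + 1 = 2 * J + d + 2 + 1 by ring,
      show J + 1 + d + J + 1 = 2 * J + d + 2 by ring,
      show J + 1 + d + (J + 1) + 1 = 2 * J + d + 2 + 1 by ring]
    have hf3 : ((2 * J + d + 2).factorial : K) ≠ 0 := natCast_factorial_ne_zero h (by omega)
    have h1 : (J + 1 + d + 1 : K) ≠ 0 := by exact_mod_cast h (J + 1 + d + 1) (by omega) (by omega)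
    have h4 : (2 * J + d + 2 + 1 : K) ≠ 0 := by
      exact_mod_cast h (2 * J + d + 2 + 1) (by omega) (by omega)
    simp only [Nat.factorial_succ (2 * J + d + 2), Nat.factorial_succ d, Nat.factorial_succ J]
    push_cast
    field_simp
    ring

theorem sum_aperyKernel {N : ℕ} (h : ∀ m : ℕ, 1 ≤ m → m ≤ 2 * N → (m : K) ≠ 0)
    {n : ℕ} (hn : n ≤ N) :
    ∑ j ∈ range n, aperyKernel K n j
    = -2 * ∑ i ∈ range n, (-1) ^ (i + 1) / (i + 1 : K) ^ 2
      - 3 * ∑ i ∈ range n, 1 / ((i + 1 : K) ^ 2 * ((2 * (i + 1)).choose (i + 1) : K)) := by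
  induction n with
  | zero => simp
  | succ n ih =>
    have key := sum_aperyKernel_sub h hn le_rfl
    rw [sum_sub_distrib, ih (by omega)] at key
    rw [sum_range_succ, sum_range_succ _ n, sum_range_succ _ n,
      sub_eq_iff_eq_add.1 key, natCast_choose_two_mul h hn]
    have hf : (n.factorial : K) ≠ 0 := natCast_factorial_ne_zero h (by omega)
    have hf2 : ((2 * n).factorial : K) ≠ 0 := natCast_factorial_ne_zero h (by omega)
    have h1 : (n + 1 : K) ≠ 0 := by exact_mod_cast h (n + 1) (by omega) (by omega)
    have h2 : (2 * n + 1 : K) ≠ 0 := by exact_mod_cast h (2 * n + 1) (by omega) (by omega)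
    have h3 : (2 : K) ≠ 0 := by exact_mod_cast h 2 (by omega) (by omega)
    have e : ((-1 : K)) ^ (n + n) = 1 := Even.neg_one_pow ⟨n, rfl⟩
    have e2 : ((-1 : K)) ^ (n + 1 + n + 1) = 1 := Even.neg_one_pow ⟨n + 1, by ring⟩
    unfold aperyKernel
    rw [e, e2, show 2 * (n + 1) = 2 * n + 1 + 1 by ring, show n + 1 + n + 1 = 2 * n + 1 + 1 by ring,
      show n + n + 1 = 2 * n + 1 by ring]
    simp only [Nat.factorial_succ, Nat.sub_self, Nat.factorial_zero]
    push_cast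
    rw [show (2 * n + 1 + 1 : K) = 2 * (n + 1) by ring]
    field_simp
    ring

end

/-! ### Euler numbers and alternating sums of odd powers -/

theorem eulerNumber_eq_zero_of_odd (n : ℕ) (hn : Odd n) : eulerNumber n = 0 := by
  induction n using Nat.strong_induction_on with
  | _ n ih =>
    obtain ⟨m, rfl⟩ : ∃ m, n = m + 1 := ⟨n - 1, by have := hn.pos; omega⟩
    rw [eulerNumber, neg_eq_zero]
    refine sum_eq_zero fun j _ => ?_
    split_ifs with hj
    · have : Odd (m - (j : ℕ)) := by
        have := j.2
        rw [Nat.odd_iff] at hn ⊢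
        rw [Nat.even_iff] at hj
        omega
      rw [ih _ (by omega) this, mul_zero]
    · rfl

/-- The value at `x` of the Appell polynomial `∑ C(q, k) E_{q-k} x^k` of the Euler numbers. -/
def eulerAppell {R : Type*} [CommRing R] (q : ℕ) (x : R) : R :=
  ∑ k ∈ range (q + 1), (q.choose k : R) * (eulerNumber (q - k) : R) * x ^ k

section
variable {R : Type*} [CommRing R]

theorem sum_choose_mul_eulerNumber_of_pos (n : ℕ) (hn : 1 ≤ n) :
    ∑ k ∈ range (n + 1), (n.choose k : R) * (eulerNumber (n - k) : R) * (1 + (-1) ^ k) = 0 := by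
  have h := congrArg (fun z : ℤ => (2 * z : R)) (eulerNumber_recursion n hn)
  rw [sum_filter] at h
  simp only [Int.cast_sum, mul_sum, Int.cast_zero, mul_zero] at h
  rw [← h]
  refine sum_congr rfl fun k _ => ?_
  split_ifs with hk
  · rw [hk.neg_one_pow]
    push_cast
    ring
  · rw [(Nat.not_even_iff_odd.1 hk).neg_one_pow]
    simp

/-- For `i < q` the coefficient of `x^i` is `C(q, i)` times twice the Euler recursion at `q - i`,
hence zero. -/
theorem eulerAppell_add_one_add_sub_one (q : ℕ) (x : R) :
    eulerAppell q (x + 1) + eulerAppell q (x - 1) = 2 * x ^ q := by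
  unfold eulerAppell
  rw [← sum_add_distrib]
  have h1 : ∀ k ∈ range (q + 1),
      (q.choose k : R) * (eulerNumber (q - k) : R) * (x + 1) ^ k
        + (q.choose k : R) * (eulerNumber (q - k) : R) * (x - 1) ^ k
      = ∑ i ∈ range (k + 1), (q.choose k : R) * (eulerNumber (q - k) : R) *
          (x ^ i * (k.choose i : R) * (1 + (-1) ^ (k - i))) := by
    intro k _
    rw [← mul_sum, ← mul_add, sub_eq_add_neg, add_pow, add_pow, ← sum_add_distrib]
    congr 1
    refine sum_congr rfl fun i _ => ?_
    rw [one_pow]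
    ring
  rw [sum_congr rfl h1]
  rw [sum_comm' (t' := range (q + 1)) (s' := fun i => Ico i (q + 1))
    (by intro a b; simp only [mem_range, mem_Ico]; omega)]
  rw [sum_range_succ, sum_eq_zero]
  · simp [eulerNumber_zero]
    ring
  · intro i hi
    rw [mem_range] at hi
    rw [sum_Ico_eq_sum_range, show q + 1 - i = q - i + 1 by omega]
    have := sum_choose_mul_eulerNumber_of_pos (R := R) (q - i) (by omega)
    rw [← mul_zero (x ^ i * (q.choose i : R)), ← this, mul_sum]
    refine sum_congr rfl fun s hs => ?_
    rw [mem_range] at hs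
    have hc := Nat.choose_mul (n := q) (k := i + s) (s := i) (by omega)
    have hc' : (q.choose (i + s) : R) * ((i + s).choose i : R)
        = (q.choose i : R) * ((q - i).choose s : R) := by
      have := congrArg (Nat.cast (R := R)) hc
      rw [Nat.add_sub_cancel_left] at this
      exact_mod_cast this
    rw [Nat.add_sub_cancel_left, Nat.sub_sub]
    linear_combination (eulerNumber (q - (i + s)) : R) * x ^ i * (1 + (-1) ^ s) * hc'

theorem eulerAppell_zero (q : ℕ) : eulerAppell q (0 : R) = eulerNumber q := by
  unfold eulerAppell
  rw [sum_range_succ', sum_eq_zero]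
  · simp
  · intro i _
    simp

theorem eulerAppell_neg_one {q : ℕ} (hq : Even q) (hq1 : 1 ≤ q) : eulerAppell q (-1 : R) = 0 := by
  unfold eulerAppell
  rw [← Int.cast_zero, ← eulerNumber_recursion q hq1, sum_filter, Int.cast_sum]
  refine sum_congr rfl fun k hk => ?_
  rw [mem_range] at hk
  split_ifs with h
  · rw [h.neg_one_pow]
    push_cast
    ring
  · rw [eulerNumber_eq_zero_of_odd]
    · simp
    · rw [Nat.even_iff] at hq h
      rw [Nat.odd_iff]
      omega

theorem two_mul_sum_alternating_odd_pow (q n : ℕ) :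
    2 * ∑ i ∈ range n, (-1) ^ i * (2 * i + 1 : R) ^ q
      = eulerNumber q - (-1) ^ n * eulerAppell q (2 * n : R) := by
  induction n with
  | zero => simp [eulerAppell_zero]
  | succ n ih =>
    have h := eulerAppell_add_one_add_sub_one q (2 * n + 1 : R)
    rw [sum_range_succ, mul_add, ih]
    rw [show (2 * n + 1 + 1 : R) = 2 * (n + 1 : ℕ) by push_cast; ring, add_sub_cancel_right] at h
    linear_combination -(-1) ^ n * h

end

/-! ### The second sum modulo `p` -/

theorem zmod_natCast_ne_zero {p m : ℕ} (h1 : 1 ≤ m) (h2 : m < p) : (m : ZMod p) ≠ 0 := by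
  rw [Ne, ZMod.natCast_eq_zero_iff]
  exact Nat.not_dvd_of_pos_of_lt h1 h2

theorem zmod_pow_sub_three {p : ℕ} [Fact p.Prime] (hp : 3 ≤ p) {x : ZMod p} (hx : x ≠ 0) :
    x ^ (p - 3) = (x ^ 2)⁻¹ := by
  refine eq_inv_of_mul_eq_one_left ?_
  rw [← pow_add, show p - 3 + 2 = p - 1 by omega]
  exact ZMod.pow_card_sub_one_eq_one hx

/-- Since `2n = -1` in `ZMod p`, the boundary term of the odd power sum is the Appell polynomial at
`-1`, which is zero. -/
theorem zmod_sum_alternating_inv_sq {p n : ℕ} [Fact p.Prime] (hp : p = 2 * n + 1) (hn : 2 ≤ n) :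
    ∑ i ∈ range n, (-1) ^ (i + 1) / ((i : ZMod p) + 1) ^ 2
      = 2 * (-1) ^ n * (eulerNumber (p - 3) : ZMod p) := by
  have hp0 : (2 * n + 1 : ZMod p) = 0 := by
    have := ZMod.natCast_self p
    rw [congrArg (Nat.cast (R := ZMod p)) hp] at this
    exact_mod_cast this
  have h := two_mul_sum_alternating_odd_pow (R := ZMod p) (p - 3) n
  rw [show (2 * n : ZMod p) = -1 by linear_combination hp0,
    eulerAppell_neg_one ⟨n - 1, by omega⟩ (by omega), mul_zero, sub_zero] at h
  rw [← h, ← sum_range_reflect, mul_sum, mul_sum]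
  refine sum_congr rfl fun i hi => ?_
  rw [mem_range] at hi
  -- `d` is the reflected index: `2i + 1 = p - 2(d + 1)`.
  obtain ⟨d, rfl⟩ : ∃ d, n = i + 1 + d := ⟨n - (i + 1), by omega⟩
  rw [show i + 1 + d - 1 - i = d by omega]
  have h1 : (2 * i + 1 : ZMod p) ≠ 0 := by
    exact_mod_cast zmod_natCast_ne_zero (p := p) (m := 2 * i + 1) (by omega) (by omega)
  have h2 : (d + 1 : ZMod p) ≠ 0 := by
    exact_mod_cast zmod_natCast_ne_zero (p := p) (m := d + 1) (by omega) (by omega)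
  rw [zmod_pow_sub_three (by omega) h1]
  push_cast at hp0
  have e : (2 * i + 1 : ZMod p) = -2 * (d + 1) := by linear_combination hp0
  have h20 : (-2 : ZMod p) ≠ 0 := fun h0 => h1 (by rw [e, h0, zero_mul])
  have h20' : (2 : ZMod p) ≠ 0 := by simpa using h20
  rw [e]
  have e2 : ((-1 : ZMod p)) ^ (i + 1 + d) * (-1) ^ i = (-1) ^ (d + 1) := by
    rw [← pow_add, show i + 1 + d + i = 2 * i + (d + 1) by ring, pow_add, pow_mul]
    simp
  rw [show ∀ a b c : ZMod p, 2 * a * (2 * (b * c)) = 4 * (a * b) * c by intros; ring, e2]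
  field_simp
  ring

/-- Wilson's theorem, moving one factor at a time by `a + 1 ≡ -(b + 1)`. -/
theorem zmod_factorial_mul_factorial {p : ℕ} [Fact p.Prime] (a b : ℕ) (h : a + b + 1 = p) :
    (a.factorial : ZMod p) * (b.factorial : ZMod p) = (-1) ^ (a + 1) := by
  induction a generalizing b with
  | zero =>
    have := ZMod.wilsons_lemma p
    rw [show p - 1 = b by omega] at this
    simp [this]
  | succ a ih =>
    have := ih (b + 1) (by omega)
    have hp0 : (a + b + 2 : ZMod p) = 0 := by
      have := ZMod.natCast_self p
      rw [← congrArg (Nat.cast (R := ZMod p)) h] at this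
      push_cast at this
      linear_combination this
    rw [Nat.factorial_succ] at this ⊢
    push_cast at this ⊢
    linear_combination -this + (a.factorial : ZMod p) * (b.factorial : ZMod p) * hp0

theorem zmod_cubeKernel_eq_aperyKernel {p n j : ℕ} [Fact p.Prime] (hp : p = 2 * n + 1)
    (hj : j < n) : cubeKernel (ZMod p) n j = aperyKernel (ZMod p) n j := by
  have h1 := zmod_factorial_mul_factorial (p := p) n n (by omega)
  have h2 := zmod_factorial_mul_factorial (p := p) (n + j + 1) (n - (j + 1)) (by omega)
  have h3 := ZMod.wilsons_lemma p
  rw [show p - 1 = 2 * n by omega] at h3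
  have hne : ((n + j + 1).factorial : ZMod p) ≠ 0 := by
    intro h0
    rw [h0, zero_mul] at h2
    exact pow_ne_zero _ (neg_ne_zero.2 one_ne_zero) h2.symm
  unfold cubeKernel aperyKernel
  have h4 : (n.factorial : ZMod p) ^ 4 = 1 := by
    rw [show (n.factorial : ZMod p) ^ 4 = ((n.factorial : ZMod p) * n.factorial) ^ 2 by ring, h1,
      ← pow_mul, mul_comm, pow_mul]
    simp
  have h5 : ((-1 : ZMod p) ^ (n + j + 1)) * (-1) ^ (n + j + 1 + 1) = -1 := by
    rw [pow_succ _ (n + j + 1), ← mul_assoc, ← mul_pow]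
    simp
  rw [h4, h3, div_eq_div_iff (by simpa using hne) hne]
  linear_combination (j.factorial : ZMod p) ^ 2 * ((n + j + 1).factorial : ZMod p) *
    ((-1) ^ (n + j + 1) * h2 + h5)

theorem zmod_sum_div_cube_centralBinom {p n : ℕ} [Fact p.Prime] (hp : p = 2 * n + 1)
    (hn : 2 ≤ n) :
    ∑ i ∈ range n, (21 * (i + 1 : ZMod p) - 8) /
        ((i + 1 : ZMod p) ^ 3 * ((2 * (i + 1)).choose (i + 1) : ZMod p) ^ 3)
      = -4 * (-1) ^ n * (eulerNumber (p - 3) : ZMod p) := by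
  have h : ∀ m : ℕ, 1 ≤ m → m ≤ 2 * n → (m : ZMod p) ≠ 0 :=
    fun m h1 h2 => zmod_natCast_ne_zero h1 (by omega)
  have h1 := sum_div_cube_centralBinom h le_rfl
  have h2 := sum_aperyKernel h le_rfl
  rw [sum_congr rfl fun j hj => zmod_cubeKernel_eq_aperyKernel hp (mem_range.1 hj), h2,
    zmod_sum_alternating_inv_sq hp hn] at h1
  rw [h1]
  ring

/-! ### From `ZMod p` to congruences of rationals -/

/-- A single integer fraction represents the sum in both fields, so an equality in `ZMod p`
transfers to `ℚ`. -/
theorem exists_fraction_sum {p : ℕ} [Fact p.Prime] (s : Finset ℕ) (a b : ℕ → ℤ)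
    (hb : ∀ i ∈ s, (b i : ZMod p) ≠ 0) :
    ∃ N D : ℤ, (D : ZMod p) ≠ 0 ∧ ∑ i ∈ s, (a i : ℚ) / (b i : ℚ) = N / D ∧
      ∑ i ∈ s, (a i : ZMod p) / (b i : ZMod p) = N / D := by
  classical
  induction s using Finset.induction_on with
  | empty => exact ⟨0, 1, by simp, by simp, by simp⟩
  | insert i s hi ih =>
    obtain ⟨N, D, hD, h1, h2⟩ := ih fun j hj => hb j (mem_insert_of_mem hj)
    have hbi := hb i (mem_insert_self i s)
    have hD' : (D : ℚ) ≠ 0 := by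
      rintro h0
      rw [Int.cast_eq_zero] at h0
      simp [h0] at hD
    have hbi' : (b i : ℚ) ≠ 0 := by
      rintro h0
      rw [Int.cast_eq_zero] at h0
      simp [h0] at hbi
    refine ⟨a i * D + b i * N, b i * D, ?_, ?_, ?_⟩
    · push_cast
      exact mul_ne_zero hbi hD
    · rw [sum_insert hi, h1, div_add_div _ _ hbi' hD']
      push_cast
      rfl
    · rw [sum_insert hi, h2, div_add_div _ _ hbi hD]
      push_cast
      rfl

theorem ratModEq_sum_div {p : ℕ} [Fact p.Prime] (s : Finset ℕ) (a b : ℕ → ℤ) (z : ℤ)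
    (hb : ∀ i ∈ s, (b i : ZMod p) ≠ 0)
    (h : ∑ i ∈ s, (a i : ZMod p) / (b i : ZMod p) = z) :
    RatModEq p (∑ i ∈ s, (a i : ℚ) / (b i : ℚ)) z := by
  obtain ⟨N, D, hD, h1, h2⟩ := exists_fraction_sum s a b hb
  rw [h2, div_eq_iff hD] at h
  have hdvd : (p : ℤ) ∣ N - z * D := by
    rw [← ZMod.intCast_zmod_eq_zero_iff_dvd]
    push_cast
    rw [h, sub_self]
  obtain ⟨t, ht⟩ := hdvd
  have hD' : (D : ℚ) ≠ 0 := by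
    rintro h0
    rw [Int.cast_eq_zero] at h0
    simp [h0] at hD
  refine ⟨(t : ℚ) / D, ?_, ?_⟩
  · rw [Nat.coprime_comm, (Fact.out : p.Prime).coprime_iff_not_dvd]
    intro hp
    apply hD
    rw [ZMod.intCast_zmod_eq_zero_iff_dvd, ← Rat.divInt_eq_div] at *
    exact (Int.natCast_dvd_natCast.2 hp).trans (Rat.den_dvd t D)
  · have ht' : (N : ℚ) - z * D = p * t := by exact_mod_cast ht
    rw [h1]
    field_simp
    linear_combination ht'

/-! ### Wolstenholme-type congruences and the sum over all `k < p` -/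

theorem zmod_ascFactorial_succ_self (p r : ℕ) :
    (((p + 1).ascFactorial r : ℕ) : ZMod p) = (r.factorial : ZMod p) := by
  induction r with
  | zero => simp
  | succ r ih =>
    rw [Nat.ascFactorial_succ, Nat.factorial_succ]
    push_cast
    rw [ih]
    simp
    ring

/-- Inverse squares are `(p-3)`-th powers, and `0 < p - 3 < p - 1`: the power sum over `ZMod p`
vanishes and zero contributes nothing. -/
theorem zmod_sum_inv_sq {p : ℕ} [Fact p.Prime] (hp : 3 < p) :
    ∑ i ∈ range (p - 1), (((i : ZMod p) + 1) ^ 2)⁻¹ = 0 := by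
  have h := FiniteField.sum_pow_lt_card_sub_one (ZMod p) (p - 3) (by rw [ZMod.card]; omega)
  have h2 : ∑ x : ZMod p, x ^ (p - 3) = ∑ i ∈ range p, (i : ZMod p) ^ (p - 3) := by
    symm
    refine sum_nbij' (fun i => (i : ZMod p)) ZMod.val (by simp) ?_ ?_ ?_ ?_
    · intro x _
      exact mem_range.2 (ZMod.val_lt x)
    · intro i hi
      exact ZMod.val_cast_of_lt (mem_range.1 hi)
    · intro x _
      simp
    · intro i _
      rfl
  rw [h2] at h
  have h3 : ∑ i ∈ range (p - 1 + 1), (i : ZMod p) ^ (p - 3) = 0 := by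
    rwa [Nat.sub_add_cancel (by omega)]
  rw [sum_range_succ', Nat.cast_zero, zero_pow (by omega), add_zero] at h3
  rw [← h3]
  refine sum_congr rfl fun i hi => ?_
  rw [mem_range] at hi
  have h1 : ((i + 1 : ℕ) : ZMod p) ≠ 0 := zmod_natCast_ne_zero (by omega) (by omega)
  rw [zmod_pow_sub_three hp.le h1]
  push_cast
  rfl

theorem cube_dvd_sum_sq {p : ℕ} [Fact p.Prime] (hp : 3 < p) (a : ℕ → ℤ)
    (h : ∀ i < p - 1, ∃ d : ℤ, a i = p * d ∧ (d : ZMod p) ^ 2 = (((i : ZMod p) + 1) ^ 2)⁻¹) :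
    (p : ℤ) ^ 3 ∣ ∑ i ∈ range (p - 1), a i ^ 2 := by
  choose! d hd hd2 using h
  have e : ∑ i ∈ range (p - 1), a i ^ 2 = (p : ℤ) ^ 2 * ∑ i ∈ range (p - 1), d i ^ 2 := by
    rw [mul_sum]
    refine sum_congr rfl fun i hi => ?_
    rw [hd i (mem_range.1 hi)]
    ring
  have h0 : (p : ℤ) ∣ ∑ i ∈ range (p - 1), d i ^ 2 := by
    rw [← ZMod.intCast_zmod_eq_zero_iff_dvd]
    push_cast
    rw [sum_congr rfl fun i hi => hd2 i (mem_range.1 hi), zmod_sum_inv_sq hp]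
  rw [e, pow_succ]
  exact mul_dvd_mul_left _ h0

theorem exists_eq_mul_of_succ_mul {p : ℕ} [Fact p.Prime] {i : ℕ} (hi : i < p - 1) (a b : ℕ)
    (h : (i + 1) * a = p * b) (hb : (b : ZMod p) ^ 2 = 1) :
    ∃ d : ℤ, (a : ℤ) = p * d ∧ (d : ZMod p) ^ 2 = (((i : ZMod p) + 1) ^ 2)⁻¹ := by
  have hpr : p.Prime := Fact.out
  obtain ⟨d, rfl⟩ : p ∣ a := (hpr.dvd_mul.1 ⟨b, h⟩).resolve_left
    (Nat.not_dvd_of_pos_of_lt (by omega) (by omega))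
  have hd : (i + 1) * d = b := by
    apply Nat.eq_of_mul_eq_mul_left hpr.pos
    rw [← h]
    ring
  refine ⟨d, by push_cast; ring, ?_⟩
  refine eq_inv_of_mul_eq_one_left ?_
  rw [← hd] at hb
  push_cast at hb ⊢
  linear_combination hb

theorem zmod_choose_sub_one {p : ℕ} [Fact p.Prime] {k : ℕ} (hk : k < p) :
    ((p - 1).choose k : ZMod p) = (-1) ^ k := by
  induction k with
  | zero => simp
  | succ k ih =>
    have hpr : p.Prime := Fact.out
    have h1 : p.choose (k + 1) = (p - 1).choose k + (p - 1).choose (k + 1) := by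
      conv_lhs => rw [show p = p - 1 + 1 by omega]
      exact Nat.choose_succ_succ _ _
    have h2 : (p.choose (k + 1) : ZMod p) = 0 := by
      rw [ZMod.natCast_eq_zero_iff]
      exact hpr.dvd_choose_self (by omega) hk
    rw [h1, Nat.cast_add, ih (by omega)] at h2
    rw [pow_succ]
    linear_combination h2

theorem choose_two_mul_prime_modEq {p : ℕ} [Fact p.Prime] (hp : 3 < p) :
    ((2 * p).choose p : ℤ) ≡ 2 [ZMOD (p : ℤ) ^ 3] := by
  have h := cube_dvd_sum_sq hp (fun i => (p.choose (i + 1) : ℤ)) (by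
    intro i hi
    refine exists_eq_mul_of_succ_mul hi _ ((p - 1).choose i) ?_ ?_
    · have := Nat.add_one_mul_choose_eq (p - 1) i
      rw [Nat.sub_add_cancel (by omega)] at this
      rw [this, mul_comm]
    · rw [zmod_choose_sub_one (by omega), ← pow_mul, mul_comm, pow_mul]
      simp)
  -- In `C(2p, p) = ∑ C(p, k)²` the end terms give 2.
  have e := Nat.sum_range_choose_sq p
  rw [sum_range_succ, show p = p - 1 + 1 by omega, sum_range_succ', Nat.sub_add_cancel (by omega)] at e
  rw [← e]
  symm
  rw [Int.modEq_iff_dvd]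
  push_cast
  simp only [Nat.choose_self, Nat.choose_zero_right]
  convert h using 1
  push_cast
  ring

theorem sum_choose_add_sq_modEq {p : ℕ} [Fact p.Prime] (hp : 3 < p) :
    ∑ k ∈ range p, ((p - 1 + k).choose k : ℤ) ^ 2 ≡ 1 [ZMOD (p : ℤ) ^ 3] := by
  have h := cube_dvd_sum_sq hp (fun i => ((p - 1 + (i + 1)).choose (i + 1) : ℤ)) (by
    intro i hi
    refine exists_eq_mul_of_succ_mul hi _ ((p + i).choose i) ?_ ?_
    · have h1 := Nat.add_one_mul_choose_eq (p - 1 + i) i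
      have h2 := Nat.add_one_mul_choose_eq (p - 1 + i) (p - 1)
      rw [show p - 1 + (i + 1) = p - 1 + i + 1 by ring, mul_comm, ← h1]
      rw [Nat.choose_symm_add, Nat.sub_add_cancel (by omega),
        show p - 1 + i + 1 = p + i by omega, Nat.choose_symm_add] at h2
      rw [show p - 1 + i + 1 = p + i by omega, h2, mul_comm]
    · have : ((p + i).choose i : ZMod p) = 1 := by
        have hl := Choose.choose_modEq_choose_mod_mul_choose_div_nat (p := p) (n := p + i) (k := i)
        rw [← ZMod.natCast_eq_natCast_iff] at hl
        rw [hl, Nat.add_mod_left, Nat.mod_eq_of_lt (by omega : i < p),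
          Nat.div_eq_of_lt (by omega : i < p)]
        simp
      rw [this, one_pow])
  rw [show range p = range (p - 1 + 1) by rw [Nat.sub_add_cancel (by omega)], sum_range_succ']
  symm
  rw [Int.modEq_iff_dvd]
  simpa using h

theorem sum_range_prime_cube_centralBinom_modEq {p : ℕ} [Fact p.Prime] (hp : 3 < p) :
    ∑ k ∈ range p, (21 * (k : ℤ) + 8) * ((2 * k).choose k : ℤ) ^ 3 ≡ 8 * p [ZMOD (p : ℤ) ^ 4] := by
  have h := sum_cube_centralBinom (p - 1)
  rw [Nat.sub_add_cancel (by omega)] at h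
  rw [h, show ((p - 1 : ℕ) : ℤ) + 1 = p by rw [Nat.cast_sub (by omega)]; ring]
  -- The factor `4p` lifts the congruence from `p³` to `4p⁴`.
  have h2 := ((choose_two_mul_prime_modEq hp).mul (sum_choose_add_sq_modEq hp)).mul_left' (c := 4 * p)
  have h3 := h2.of_dvd (m := (p : ℤ) ^ 4) ⟨4, by ring⟩
  rw [← mul_assoc] at h3
  convert h3 using 1
  ring

/-! ### The upper half of the sum and the conclusion -/

theorem exists_choose_two_mul_prime_sub {p n i : ℕ} [Fact p.Prime] (hp : p = 2 * n + 1)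
    (hi : i < n) :
    ∃ c : ℤ, ((2 * (p - (i + 1))).choose (p - (i + 1)) : ℤ) = p * c ∧
      (c : ZMod p) = -2 / ((i + 1) * ((2 * (i + 1)).choose (i + 1) : ZMod p)) := by
  have hpr : p.Prime := Fact.out
  obtain ⟨m, hm⟩ : ∃ m, m = p - (i + 1) := ⟨_, rfl⟩
  obtain ⟨r, hr⟩ : ∃ r, r = p - 2 * (i + 1) := ⟨_, rfl⟩
  rw [← hm]
  have hC := Nat.add_choose_mul_factorial_mul_factorial m m
  rw [← two_mul] at hC
  -- `(2m)! = p! (p+1)⋯(p+r)` isolates the single factor `p`; the cofactor is `(p-1)! r!` modulo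
  -- `p`.
  have hA := Nat.factorial_mul_ascFactorial p r
  rw [show p + r = 2 * m by omega, ← hC, ← Nat.mul_factorial_pred hpr.ne_zero] at hA
  have hnd : ¬ p ∣ m.factorial := by
    rw [hpr.dvd_factorial]
    omega
  obtain ⟨c, hc⟩ : p ∣ (2 * m).choose m := by
    have h1 : p ∣ (2 * m).choose m * m.factorial * m.factorial := by
      rw [← hA, mul_assoc]
      exact dvd_mul_right _ _
    exact (hpr.dvd_mul.1 ((hpr.dvd_mul.1 h1).resolve_right hnd)).resolve_right hnd
  have hcm : (p - 1).factorial * (p + 1).ascFactorial r = c * m.factorial * m.factorial := by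
    apply Nat.eq_of_mul_eq_mul_left hpr.pos
    rw [← mul_assoc, hA, hc]
    ring
  have hz := congrArg (Nat.cast (R := ZMod p)) hcm
  push_cast at hz
  rw [ZMod.wilsons_lemma, zmod_ascFactorial_succ_self] at hz
  have hm1 := zmod_factorial_mul_factorial (p := p) m i (by omega)
  have hr1 := zmod_factorial_mul_factorial (p := p) r (2 * i + 1) (by omega)
  rw [Even.neg_one_pow (n := r + 1) ⟨n - i, by omega⟩] at hr1
  have h : ∀ k : ℕ, 1 ≤ k → k ≤ 2 * n → (k : ZMod p) ≠ 0 :=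
    fun k h1 h2 => zmod_natCast_ne_zero h1 (by omega)
  refine ⟨c, by exact_mod_cast hc, ?_⟩
  rw [natCast_choose_two_mul h (n := i + 1) (by omega), show 2 * (i + 1) = 2 * i + 1 + 1 by ring,
    Nat.factorial_succ (2 * i + 1), Nat.factorial_succ i]
  have hf1 : (i.factorial : ZMod p) ≠ 0 := natCast_factorial_ne_zero h (by omega)
  have hf2 : ((2 * i + 1).factorial : ZMod p) ≠ 0 := natCast_factorial_ne_zero h (by omega)
  have hi1 : (i + 1 : ZMod p) ≠ 0 := by exact_mod_cast h (i + 1) (by omega) (by omega)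
  have h2 : (2 : ZMod p) ≠ 0 := by exact_mod_cast h 2 (by omega) (by omega)
  have hsq : ((m.factorial : ZMod p) * i.factorial) ^ 2 = 1 := by
    rw [hm1, ← pow_mul, mul_comm, pow_mul]
    simp
  have key : (c : ZMod p) * (2 * i + 1).factorial = - (i.factorial : ZMod p) ^ 2 := by
    linear_combination (-(c : ZMod p) * (2 * i + 1).factorial) * hsq
      - (i.factorial : ZMod p) ^ 2 * (2 * i + 1).factorial * hz
      - (i.factorial : ZMod p) ^ 2 * hr1
  push_cast
  rw [show (2 * i + 1 + 1 : ZMod p) = 2 * (i + 1) by ring]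
  field_simp
  linear_combination key

theorem sum_upper_half_cube_centralBinom_modEq {p n : ℕ} [Fact p.Prime] (hp : p = 2 * n + 1)
    (hn : 2 ≤ n) :
    ∑ i ∈ range n, (21 * ((p - (i + 1) : ℕ) : ℤ) + 8) *
        ((2 * (p - (i + 1))).choose (p - (i + 1)) : ℤ) ^ 3
      ≡ -32 * (-1) ^ n * (p : ℤ) ^ 3 * eulerNumber (p - 3) [ZMOD (p : ℤ) ^ 4] := by
  have hex : ∀ i < n, _ := fun i hi => exists_choose_two_mul_prime_sub (p := p) (i := i) hp hi
  choose! c hc hc' using hex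
  have e : ∑ i ∈ range n, (21 * ((p - (i + 1) : ℕ) : ℤ) + 8) *
        ((2 * (p - (i + 1))).choose (p - (i + 1)) : ℤ) ^ 3
      = (p : ℤ) ^ 3 * ∑ i ∈ range n, (21 * ((p - (i + 1) : ℕ) : ℤ) + 8) * c i ^ 3 := by
    rw [mul_sum]
    refine sum_congr rfl fun i hi => ?_
    rw [hc i (mem_range.1 hi)]
    ring
  have hmod : ∑ i ∈ range n, (21 * ((p - (i + 1) : ℕ) : ℤ) + 8) * c i ^ 3
      ≡ -32 * (-1) ^ n * eulerNumber (p - 3) [ZMOD p] := by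
    rw [← ZMod.intCast_eq_intCast_iff]
    push_cast
    have h := zmod_sum_div_cube_centralBinom hp hn
    -- The 8 is `-(-2)³`: modulo `p`, `21(p-j) + 8 ≡ -(21j - 8)` and `c³` contributes `(-2)³`.
    rw [show (-32 * (-1) ^ n * (eulerNumber (p - 3) : ZMod p))
      = 8 * (-4 * (-1) ^ n * (eulerNumber (p - 3) : ZMod p)) by ring, ← h, mul_sum]
    refine sum_congr rfl fun i hi => ?_
    rw [mem_range] at hi
    rw [hc' i hi, Nat.cast_sub (by omega), ZMod.natCast_self]
    push_cast
    rw [div_pow, mul_pow]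
    ring
  rw [e]
  have := hmod.mul_left' (c := (p : ℤ) ^ 3)
  rw [← pow_succ] at this
  convert this using 1
  ring

theorem theorem1p4 (p : ℕ) (hp : p.Prime) (hp3 : 3 < p) :
    (∑ k ∈ Finset.range ((p - 1) / 2 + 1), (21 * (k : ℤ) + 8) * ((2 * k).choose k : ℤ) ^ 3
        ≡ 8 * (p : ℤ) + (-1) ^ ((p - 1) / 2) * 32 * (p : ℤ) ^ 3 * eulerNumber (p - 3)
        [ZMOD (p : ℤ) ^ 4]) ∧
    RatModEq p
      (∑ k ∈ Finset.Icc 1 ((p - 1) / 2),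
        (21 * (k : ℚ) - 8) / ((k : ℚ) ^ 3 * ((2 * k).choose k : ℚ) ^ 3))
      ((-1) ^ ((p + 1) / 2) * 4 * (eulerNumber (p - 3) : ℚ)) := by
  have : Fact p.Prime := ⟨hp⟩
  obtain ⟨n, hn⟩ : ∃ n, p = 2 * n + 1 := hp.odd_of_ne_two (by omega)
  have hn2 : 2 ≤ n := by omega
  rw [show (p - 1) / 2 = n by omega, show (p + 1) / 2 = n + 1 by omega]
  constructor
  · have h1 := sum_range_prime_cube_centralBinom_modEq hp3
    have h2 := sum_upper_half_cube_centralBinom_modEq hn hn2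
    have hsplit : ∑ k ∈ range p, (21 * (k : ℤ) + 8) * ((2 * k).choose k : ℤ) ^ 3
        = ∑ k ∈ range (n + 1), (21 * (k : ℤ) + 8) * ((2 * k).choose k : ℤ) ^ 3
        + ∑ i ∈ range n, (21 * ((p - (i + 1) : ℕ) : ℤ) + 8) *
          ((2 * (p - (i + 1))).choose (p - (i + 1)) : ℤ) ^ 3 := by
      rw [show range p = range (n + 1 + n) by rw [hn]; congr 1; ring, sum_range_add,
        ← sum_range_reflect _ n]
      congr 1
      refine sum_congr rfl fun i hi => ?_
      rw [mem_range] at hi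
      rw [show n + 1 + (n - 1 - i) = p - (i + 1) by omega]
    rw [hsplit] at h1
    have h3 := h1.sub h2
    rw [add_sub_cancel_right] at h3
    convert h3 using 1
    ring
  · have hz := zmod_sum_div_cube_centralBinom hn hn2
    have h := ratModEq_sum_div (p := p) (range n) (fun i => 21 * ((i : ℤ) + 1) - 8)
      (fun i => ((i : ℤ) + 1) ^ 3 * ((2 * (i + 1)).choose (i + 1) : ℤ) ^ 3)
      ((-1) ^ (n + 1) * 4 * eulerNumber (p - 3)) (by
        intro i hi
        rw [mem_range] at hi
        have h : ∀ k : ℕ, 1 ≤ k → k ≤ 2 * n → (k : ZMod p) ≠ 0 :=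
          fun k h1 h2 => zmod_natCast_ne_zero h1 (by omega)
        have hi1 : (i + 1 : ZMod p) ≠ 0 := by exact_mod_cast h (i + 1) (by omega) (by omega)
        push_cast
        refine mul_ne_zero (pow_ne_zero _ hi1) (pow_ne_zero _ ?_)
        rw [natCast_choose_two_mul h (n := i + 1) (by omega)]
        exact div_ne_zero (natCast_factorial_ne_zero h (by omega))
          (pow_ne_zero _ (natCast_factorial_ne_zero h (by omega)))) (by
        push_cast
        rw [hz]
        ring)
    rw [← Ico_add_one_right_eq_Icc, sum_Ico_eq_sum_range, Nat.add_sub_cancel]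
    push_cast at h
    convert h using 1
    refine sum_congr rfl fun i _ => ?_
    rw [add_comm 1 i]
    push_cast
    rfl
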